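/- Consider the scalar delay differential equation $$\ddot x(t)+a\,\dot x(t)+b\,x(t)+a_1(t)\,\dot x(g(t))+b_1(t)\,x(h(t))=0, \qquad (2)$$ where $a,b>0$ are constants with $a^2\ge 4b$; $a_1,b_1$ are Lebesgue measurable, essentially bounded functions on $[0,\infty)$; and $g,h:[0,\infty)\to\mathbb R$ are Lebesgue measurable with $g(t)\le t$, $h(t)\le t$ for $t\ge 0$ and bounded delays: $\limsup_{t\to\infty}(t-g(t))<\infty$, $\limsup_{t\to\infty}(t-h(t))<\infty$. Suppose that for some $t_0\ge 0$, with $\|\cdot\|$ denoting the norm of $L_\infty[t_0,\infty)$, $$a>\|a_1\|,\qquad \|a_1\|\,(b+\|b_1\|)<(a-\|a_1\|)(b-\|b_1\|).$$ Then equation (2) is (uniformly) exponentially stable: there exist $M>0$ and $\mu>0$ such that for every $s\ge 0$, all bounded Borel measurable functions $\varphi,\psi:(-\infty,s)\to\mathbb R$ and all $x_0,x_0'\in\mathbb R$, the solution $x$ of (2) on $[s,\infty)$ with $x(t)=\varphi(t)$, $\dot x(t)=\psi(t)$ for $t<s$, and $x(s)=x_0$, $\dot x(s)=x_0'$, satisfies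 $$|x(t)|\le M e^{-\mu(t-s)}\Big[\,|x_0|+|x_0'|+\sup_{r<s}\big(|\varphi(r)|+|\psi(r)|\big)\Big],\qquad t\ge s.$$ Here $\psi$ is prescribed independently of $\varphi$ (for $r<s$ the symbol $\dot x(r)$ just means $\psi(r)$), and a solution is a function $x$ whose derivative $\dot x$ on $[s,\infty)$ is locally absolutely continuous and which satisfies (2) for almost every $t\ge s$. -/

import Mathlib

open Set Filter MeasureTheory

noncomputable section

namespace DelayDE

/-- The norm of `f` in `L_∞[t₀, ∞)` with respect to Lebesgue measure (meaningful when `f` is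
essentially bounded there). -/
def supNorm (t₀ : ℝ) (f : ℝ → ℝ) : ℝ :=
  (eLpNorm f ⊤ (volume.restrict (Ici t₀))).toReal

/-- A coefficient: a Lebesgue measurable, essentially bounded function on `[0, ∞)`
(values at negative arguments play no role). -/
def IsCoefficient (f : ℝ → ℝ) : Prop :=
  MemLp f ⊤ (volume.restrict (Ici 0))

/-- A bounded delay: `g` is Lebesgue measurable on `[0, ∞)` (for real-valued functions this is
almost everywhere measurability), `g t ≤ t` for `t ≥ 0`, and `limsup (t - g t) < ∞` as `t → ∞`.
Values at negative arguments play no role. -/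
structure IsBoundedDelay (g : ℝ → ℝ) : Prop where
  measurable : AEMeasurable g (volume.restrict (Ici 0))
  le_self : ∀ t, 0 ≤ t → g t ≤ t
  bounded : IsBoundedUnder (· ≤ ·) atTop (fun t => t - g t)

/-- `x`, with derivative `x'`, is a solution of the initial value problem
`ẍ(t) + a(t) ẋ(t) + b(t) x(t) + a₁(t) ẋ(g(t)) + b₁(t) x(h(t)) = 0` for `t ≥ t₀`,
`x(t) = φ(t)`, `ẋ(t) = ψ(t)` for `t < t₀`, `x(t₀) = x₀`, `ẋ(t₀) = x₀'`.

The prehistory `ψ` of the derivative is prescribed independently of `φ`. So `ẋ` is carried as a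
function `x'` of its own: it is `ψ` before `t₀`, and the actual derivative of `x` (one-sided
at `t₀`) on `[t₀, ∞)`, where it is locally absolutely continuous. -/
structure IsSolution (a b a₁ b₁ g h : ℝ → ℝ) (t₀ : ℝ) (φ ψ : Iio t₀ → ℝ) (x₀ x₀' : ℝ)
    (x x' : ℝ → ℝ) : Prop where
  eq_pre : ∀ t : Iio t₀, x t = φ t
  deriv_eq_pre : ∀ t : Iio t₀, x' t = ψ t
  eq_init : x t₀ = x₀
  deriv_eq_init : x' t₀ = x₀'
  hasDeriv : ∀ t, t₀ ≤ t → HasDerivWithinAt x (x' t) (Ici t₀) t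
  absCont : ∀ T, t₀ ≤ T → AbsolutelyContinuousOnInterval x' t₀ T
  equation : ∀ᵐ t ∂volume.restrict (Ici t₀), ∃ x'' : ℝ, HasDerivAt x' x'' t ∧
    x'' + a t * x' t + b t * x t + a₁ t * x' (g t) + b₁ t * x (h t) = 0

/-- (Uniform) exponential stability of
`ẍ(t) + a(t) ẋ(t) + b(t) x(t) + a₁(t) ẋ(g(t)) + b₁(t) x(h(t)) = 0`: one pair `M, μ > 0` serves
for all initial times `t₀ ≥ 0`, all bounded Borel initial functions and all initial values. -/
def IsExponentiallyStable (a b a₁ b₁ g h : ℝ → ℝ) : Prop :=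
  ∃ M μ : ℝ, 0 < M ∧ 0 < μ ∧
    ∀ t₀ : ℝ, 0 ≤ t₀ →
    ∀ φ ψ : Iio t₀ → ℝ, Measurable φ → Measurable ψ →
      BddAbove (range fun t => |φ t|) → BddAbove (range fun t => |ψ t|) →
    ∀ (x₀ x₀' : ℝ) (x x' : ℝ → ℝ), IsSolution a b a₁ b₁ g h t₀ φ ψ x₀ x₀' x x' →
    ∀ t, t₀ ≤ t →
      |x t| ≤ M * Real.exp (-μ * (t - t₀)) *
        (|x₀| + |x₀'| + ⨆ s : Iio t₀, (|φ s| + |ψ s|))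

end DelayDE

end

/-! Since `a ^ 2 ≥ 4 * b`, the undelayed operator factors as `(d/dt + p)(d/dt + q)` with `p, q > 0`.
Treat the delayed terms as a forcing, let `m`, `m'` be the maxima of `exp (μ (t - s)) |x|` and `exp
(μ (t - s)) |x'|` on a compact interval, and let `A`, `B` be the norms of `a₁`, `b₁`. Two
applications of the first-order bound `exp_mul_abs_le_of_ae_hasDerivAt` control `m`; reading the
equation as `ẍ + a ẋ = f - b x` controls `m'`. At `μ = 0`, up to multiples of the data, `(b - B) m ≤
A m'` and `(a - A) m' ≤ (b + B) m`. Eliminating `m'` leaves `(a - A)(b - B) - A (b + B)` times `m`,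
positive by hypothesis; the maxima are finite, so `m` can be absorbed, uniformly in the interval
(`exp_mul_abs_le_of_small_gain`). Bounded delays cost only a factor `exp (μ τ)`, and strictness
leaves room for some `μ > 0` (`exists_weight`). This works from a time `T₀` on; before it,
`abs_le_exp_growth` limits the growth of the solution. -/

namespace DelayDE

/-! ### First-order equations and delayed terms in weighted norms -/

/-- Weighted bound for the scalar equation `u' + c u = f` with `|f t| ≤ F exp (-μ (t - s))`. -/
lemma exp_mul_abs_le_of_ae_hasDerivAt {u : ℝ → ℝ} {c μ F s T : ℝ} (hcμ : μ < c)
    (hu : AbsolutelyContinuousOnInterval u s T)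
    (hd : ∀ᵐ t, t ∈ Ioc s T → ∃ u', HasDerivAt u u' t ∧
      Real.exp (μ * (t - s)) * |u' + c * u t| ≤ F) (hF : 0 ≤ F) {t : ℝ} (ht : t ∈ Icc s T) :
    Real.exp (μ * (t - s)) * |u t| ≤ |u s| + F / (c - μ) := by
  have hpos : 0 < c - μ := sub_pos.2 hcμ
  have hut : AbsolutelyContinuousOnInterval u s t := hu.mono (by
    rw [uIcc_of_le ht.1, uIcc_of_le (ht.1.trans ht.2)]
    exact Icc_subset_Icc_right ht.2)
  -- Integrating factor: the derivative of `exp (c (r - s)) u` is dominated by `F exp ((c - μ) (r -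
  -- s))`, whose integral is explicit.
  have hexp : AbsolutelyContinuousOnInterval (fun r => Real.exp (c * (r - s))) s t :=
    ContDiffOn.absolutelyContinuousOnInterval (by fun_prop)
  have hv := hexp.mul hut
  have hint := hv.integral_deriv_eq_sub
  have hW : ∀ r, HasDerivAt (fun r => F / (c - μ) * Real.exp ((c - μ) * (r - s)))
      (F * Real.exp ((c - μ) * (r - s))) r := by
    intro r
    have h1 : HasDerivAt (fun r : ℝ => (c - μ) * (r - s)) (c - μ) r := by
      simpa using ((hasDerivAt_id r).sub_const s).const_mul (c - μ)
    convert! h1.exp.const_mul (F / (c - μ)) using 1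
    field_simp
  have hWi : IntervalIntegrable (fun r => F * Real.exp ((c - μ) * (r - s))) volume s t :=
    Continuous.intervalIntegrable (by fun_prop) _ _
  have hWint := intervalIntegral.integral_eq_sub_of_hasDerivAt (fun r _ => hW r) hWi
  have hle := intervalIntegral.norm_integral_le_of_norm_le (μ := volume) ht.1
    (f := deriv ((fun r => Real.exp (c * (r - s))) * u))
    (g := fun r => F * Real.exp ((c - μ) * (r - s))) (by
      filter_upwards [hd] with r hr hrt
      obtain ⟨u', hu', hb⟩ := hr ⟨hrt.1, hrt.2.trans ht.2⟩
      have h1 : HasDerivAt (fun r : ℝ => c * (r - s)) c r := by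
        simpa using ((hasDerivAt_id r).sub_const s).const_mul c
      rw [(h1.exp.mul hu').deriv]
      have h2 : Real.exp (c * (r - s)) * c * u r + Real.exp (c * (r - s)) * u'
          = Real.exp ((c - μ) * (r - s)) * (Real.exp (μ * (r - s)) * (u' + c * u r)) := by
        rw [← mul_assoc, ← Real.exp_add]
        ring_nf
      rw [h2, Real.norm_eq_abs, abs_mul, abs_mul, Real.abs_exp, Real.abs_exp, mul_comm F]
      gcongr) hWi
  rw [hint, hWint] at hle
  simp only [Pi.mul_apply, sub_self, mul_zero, Real.exp_zero, one_mul, mul_one,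
    Real.norm_eq_abs] at hle
  have h3 := (abs_sub_abs_le_abs_sub _ _).trans hle
  rw [abs_mul, Real.abs_exp] at h3
  have hK : 0 ≤ F / (c - μ) := by positivity
  have h4 : Real.exp (c * (t - s)) * |u t| ≤
      (|u s| + F / (c - μ)) * Real.exp ((c - μ) * (t - s)) := by
    have h5 : 1 ≤ Real.exp ((c - μ) * (t - s)) :=
      Real.one_le_exp (mul_nonneg hpos.le (sub_nonneg.2 ht.1))
    nlinarith [abs_nonneg (u s)]
  have h6 : Real.exp (c * (t - s)) =
      Real.exp (μ * (t - s)) * Real.exp ((c - μ) * (t - s)) := by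
    rw [← Real.exp_add]; ring_nf
  rw [h6, mul_right_comm] at h4
  exact le_of_mul_le_mul_right h4 (Real.exp_pos _)

/-- Weighted bound for a delayed term, from a bound on the prehistory and a weighted bound on the
solution. -/
lemma exp_mul_abs_delay_le {y : ℝ → ℝ} {μ s T E C m t r : ℝ} (htT : t ≤ T) (hC : 0 ≤ C)
    (hm : 0 ≤ m) (hpre : ∀ r, r < s → |y r| ≤ C)
    (hy : ∀ r ∈ Icc s T, Real.exp (μ * (r - s)) * |y r| ≤ m)
    (hr : r ≤ t) (hE : Real.exp (μ * (t - r)) ≤ E)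
    (hE' : r < s → Real.exp (μ * (t - s)) ≤ E) :
    Real.exp (μ * (t - s)) * |y r| ≤ E * (C + m) := by
  have hE0 : 0 ≤ E := (Real.exp_pos _).le.trans hE
  rcases lt_or_ge r s with h | h
  · calc _ ≤ E * C := mul_le_mul (hE' h) (hpre r h) (abs_nonneg _) hE0
      _ ≤ _ := by gcongr; linarith
  · have h6 : Real.exp (μ * (t - s)) = Real.exp (μ * (t - r)) * Real.exp (μ * (r - s)) := by
      rw [← Real.exp_add]; ring_nf
    rw [h6, mul_assoc]
    calc _ ≤ E * m := mul_le_mul hE (hy r ⟨h, hr.trans htT⟩) (by positivity) hE0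
      _ ≤ _ := by gcongr; linarith

/-! ### A priori estimates for the second-order equation -/

/-- `x`, with derivative `x'`, solves the equation with constant `a`, `b` on `[s, ∞)`; its
prehistory is whatever `x` and `x'` are before `s`. -/
structure SolvesFrom (a b : ℝ) (a₁ b₁ g h : ℝ → ℝ) (s : ℝ) (x x' : ℝ → ℝ) : Prop where
  hasDeriv : ∀ t, s ≤ t → HasDerivWithinAt x (x' t) (Ici s) t
  absCont : ∀ T, s ≤ T → AbsolutelyContinuousOnInterval x' s T
  equation : ∀ᵐ t ∂volume.restrict (Ici s), ∃ x'' : ℝ, HasDerivAt x' x'' t ∧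
    x'' + a * x' t + b * x t + a₁ t * x' (g t) + b₁ t * x (h t) = 0

namespace SolvesFrom

variable {a b : ℝ} {a₁ b₁ g h x x' : ℝ → ℝ} {s : ℝ}

/-- Allows a restart at a later time, with the solution so far as the new prehistory. -/
lemma mono (hx : SolvesFrom a b a₁ b₁ g h s x x') {s' : ℝ} (hs : s ≤ s') :
    SolvesFrom a b a₁ b₁ g h s' x x' where
  hasDeriv t ht := (hx.hasDeriv t (hs.trans ht)).mono (Ici_subset_Ici.2 hs)
  absCont T hT := (hx.absCont T (hs.trans hT)).mono (by
    rw [uIcc_of_le hT, uIcc_of_le (hs.trans hT)]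
    exact Icc_subset_Icc_left hs)
  equation := ae_restrict_of_ae_restrict_of_subset (Ici_subset_Ici.2 hs) hx.equation

lemma hasDerivAt (hx : SolvesFrom a b a₁ b₁ g h s x x') {t : ℝ} (ht : s < t) :
    HasDerivAt x (x' t) t :=
  (hx.hasDeriv t ht.le).hasDerivAt (Ici_mem_nhds ht)

lemma absolutelyContinuousOnInterval (hx : SolvesFrom a b a₁ b₁ g h s x x') {T : ℝ}
    (hT : s ≤ T) : AbsolutelyContinuousOnInterval x s T := by
  obtain ⟨C, hC⟩ := (hx.absCont T hT).exists_bound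
  have hC0 : 0 ≤ C := (norm_nonneg _).trans (hC s left_mem_uIcc)
  rw [uIcc_of_le hT] at hC
  refine LipschitzOnWith.absolutelyContinuousOnInterval (K := ⟨C, hC0⟩) ?_
  rw [uIcc_of_le hT]
  exact (convex_Icc s T).lipschitzOnWith_of_nnnorm_hasDerivWithin_le
    (fun t ht => (hx.hasDeriv t ht.1).mono Icc_subset_Ici_self) (fun t ht => hC t ht)

/-- The weighted supremum of an absolutely continuous function over `[s, T]` is attained. -/
lemma _root_.AbsolutelyContinuousOnInterval.exists_exp_mul_abs_max {y : ℝ → ℝ} {T : ℝ}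
    (hy : AbsolutelyContinuousOnInterval y s T) (hT : s ≤ T) (μ : ℝ) :
    ∃ r ∈ Icc s T, ∀ t ∈ Icc s T,
      Real.exp (μ * (t - s)) * |y t| ≤ Real.exp (μ * (r - s)) * |y r| := by
  have hc : ContinuousOn (fun t => Real.exp (μ * (t - s)) * |y t|) (Icc s T) := by
    have := hy.continuousOn
    rw [uIcc_of_le hT] at this
    exact ContinuousOn.mul (by fun_prop) this.abs
  obtain ⟨r, hr, hmax⟩ := isCompact_Icc.exists_isMaxOn ⟨s, left_mem_Icc.2 hT⟩ hc
  exact ⟨r, hr, fun t ht => hmax ht⟩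

/-- The delayed terms are controlled, in the weighted norm, by the prehistory and by the weighted
suprema of `x` and `x'`. -/
lemma exp_mul_abs_forcing_le (hx : SolvesFrom a b a₁ b₁ g h s x x') {T μ E A B C m m' : ℝ}
    (hC : 0 ≤ C) (hm : 0 ≤ m) (hm' : 0 ≤ m')
    (hA : ∀ᵐ t ∂volume.restrict (Ici s), |a₁ t| ≤ A)
    (hB : ∀ᵐ t ∂volume.restrict (Ici s), |b₁ t| ≤ B)
    (hg : ∀ t ∈ Icc s T, g t ≤ t ∧ Real.exp (μ * (t - g t)) ≤ E ∧
      (g t < s → Real.exp (μ * (t - s)) ≤ E))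
    (hh : ∀ t ∈ Icc s T, h t ≤ t ∧ Real.exp (μ * (t - h t)) ≤ E ∧
      (h t < s → Real.exp (μ * (t - s)) ≤ E))
    (hpre : ∀ r, r < s → |x r| ≤ C) (hpre' : ∀ r, r < s → |x' r| ≤ C)
    (hxm : ∀ t ∈ Icc s T, Real.exp (μ * (t - s)) * |x t| ≤ m)
    (hxm' : ∀ t ∈ Icc s T, Real.exp (μ * (t - s)) * |x' t| ≤ m') :
    ∀ᵐ t, t ∈ Ioc s T → ∃ x'', HasDerivAt x' x'' t ∧
      Real.exp (μ * (t - s)) * |x'' + a * x' t + b * x t| ≤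
        A * (E * (C + m')) + B * (E * (C + m)) := by
  have heq := hx.equation
  rw [ae_restrict_iff' measurableSet_Ici] at heq hA hB
  filter_upwards [heq, hA, hB] with t h1 h2 h3 ht
  have htI : t ∈ Icc s T := Ioc_subset_Icc_self ht
  obtain ⟨x'', hd, he⟩ := h1 htI.1
  refine ⟨x'', hd, ?_⟩
  have hgt := exp_mul_abs_delay_le ht.2 hC hm' hpre' hxm' (hg t htI).1 (hg t htI).2.1 (hg t htI).2.2
  have hht := exp_mul_abs_delay_le ht.2 hC hm hpre hxm (hh t htI).1 (hh t htI).2.1 (hh t htI).2.2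
  have h4 : x'' + a * x' t + b * x t = -(a₁ t * x' (g t) + b₁ t * x (h t)) := by linarith
  rw [h4, abs_neg]
  calc _ ≤ Real.exp (μ * (t - s)) * (|a₁ t| * |x' (g t)| + |b₁ t| * |x (h t)|) := by
        gcongr
        rw [← abs_mul, ← abs_mul]
        exact abs_add_le _ _
    _ = |a₁ t| * (Real.exp (μ * (t - s)) * |x' (g t)|) +
        |b₁ t| * (Real.exp (μ * (t - s)) * |x (h t)|) := by ring
    _ ≤ _ := by
        gcongr
        · exact (abs_nonneg _).trans (h2 htI.1)
        · exact h2 htI.1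
        · exact (abs_nonneg _).trans (h3 htI.1)
        · exact h3 htI.1

/-- Weighted bound for `x'`, from the equation read as `ẍ + a ẋ = f - b x`. -/
lemma exp_mul_abs_deriv_le (hx : SolvesFrom a b a₁ b₁ g h s x x') {T μ F m : ℝ} (hT : s ≤ T)
    (hb : 0 ≤ b) (hμ : μ < a) (hF : 0 ≤ F) (hm : 0 ≤ m)
    (hxm : ∀ t ∈ Icc s T, Real.exp (μ * (t - s)) * |x t| ≤ m)
    (hf : ∀ᵐ t, t ∈ Ioc s T → ∃ x'', HasDerivAt x' x'' t ∧
      Real.exp (μ * (t - s)) * |x'' + a * x' t + b * x t| ≤ F) {t : ℝ} (ht : t ∈ Icc s T) :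
    Real.exp (μ * (t - s)) * |x' t| ≤ |x' s| + (F + b * m) / (a - μ) := by
  refine exp_mul_abs_le_of_ae_hasDerivAt hμ (hx.absCont T hT) ?_ (by positivity) ht
  filter_upwards [hf] with r hr hrI
  obtain ⟨x'', hd, hle⟩ := hr hrI
  refine ⟨x'', hd, ?_⟩
  have h1 : |x'' + a * x' r| ≤ |x'' + a * x' r + b * x r| + b * |x r| := by
    have := abs_sub (x'' + a * x' r + b * x r) (b * x r)
    rwa [add_sub_cancel_right, abs_mul b, abs_of_nonneg hb] at this
  have h2 := hxm r (Ioc_subset_Icc_self hrI)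
  calc _ ≤ Real.exp (μ * (r - s)) * (|x'' + a * x' r + b * x r| + b * |x r|) := by gcongr
    _ = Real.exp (μ * (r - s)) * |x'' + a * x' r + b * x r| +
        b * (Real.exp (μ * (r - s)) * |x r|) := by ring
    _ ≤ _ := by gcongr

/-- Weighted bound for `x`, from a weighted bound on `x' + c x`. -/
lemma exp_mul_abs_le (hx : SolvesFrom a b a₁ b₁ g h s x x') {T μ c F : ℝ} (hT : s ≤ T)
    (hμ : μ < c) (hF : 0 ≤ F)
    (hf : ∀ t ∈ Icc s T, Real.exp (μ * (t - s)) * |x' t + c * x t| ≤ F)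
    {t : ℝ} (ht : t ∈ Icc s T) :
    Real.exp (μ * (t - s)) * |x t| ≤ |x s| + F / (c - μ) :=
  exp_mul_abs_le_of_ae_hasDerivAt hμ (hx.absolutelyContinuousOnInterval hT)
    (ae_of_all _ fun r hr => ⟨x' r, hx.hasDerivAt hr.1, hf r (Ioc_subset_Icc_self hr)⟩) hF ht

/-- Weighted bound for `x' + q x`, where the characteristic polynomial of the equation without
delayed terms is `(z + p) (z + q)`. -/
lemma exp_mul_abs_factor_le {p q : ℝ} (hx : SolvesFrom (p + q) (p * q) a₁ b₁ g h s x x')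
    {T μ F : ℝ} (hT : s ≤ T) (hμ : μ < p) (hF : 0 ≤ F)
    (hf : ∀ᵐ t, t ∈ Ioc s T → ∃ x'', HasDerivAt x' x'' t ∧
      Real.exp (μ * (t - s)) * |x'' + (p + q) * x' t + p * q * x t| ≤ F)
    {t : ℝ} (ht : t ∈ Icc s T) :
    Real.exp (μ * (t - s)) * |x' t + q * x t| ≤ |x' s + q * x s| + F / (p - μ) := by
  refine exp_mul_abs_le_of_ae_hasDerivAt (u := fun t => x' t + q * x t) hμ
    ((hx.absCont T hT).add ((hx.absolutelyContinuousOnInterval hT).const_mul q)) ?_ hF ht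
  filter_upwards [hf] with r hr hrI
  obtain ⟨x'', hd, hle⟩ := hr hrI
  refine ⟨x'' + q * x' r, hd.add ((hx.hasDerivAt hrI.1).const_mul q), ?_⟩
  convert! hle using 3
  ring

/-- Exponential growth bound, valid for arbitrary (even unbounded) delays. -/
lemma abs_le_exp_growth (hx : SolvesFrom a b a₁ b₁ g h s x x') {A B C : ℝ} (ha : 0 ≤ a)
    (hb : 0 ≤ b) (hA0 : 0 ≤ A) (hB0 : 0 ≤ B) (hC : 0 ≤ C)
    (hA : ∀ᵐ t ∂volume.restrict (Ici s), |a₁ t| ≤ A)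
    (hB : ∀ᵐ t ∂volume.restrict (Ici s), |b₁ t| ≤ B)
    (hg : ∀ t, s ≤ t → g t ≤ t) (hh : ∀ t, s ≤ t → h t ≤ t)
    (hpre : ∀ r, r ≤ s → |x r| ≤ C) (hpre' : ∀ r, r ≤ s → |x' r| ≤ C) {t : ℝ} (ht : s ≤ t) :
    |x t| ≤ 5 * C * Real.exp (2 * (1 + b + A + B) * (t - s)) ∧
      |x' t| ≤ 5 * C * Real.exp (2 * (1 + b + A + B) * (t - s)) := by
  -- The factor 2 gives `m + m' ≤ 2 C + (m + m' + C) / 2` below, hence the constant 5.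
  set κ := 2 * (1 + b + A + B) with hκ
  have hκ0 : 0 < κ := by positivity
  obtain ⟨r, hr, hmax⟩ :=
    (hx.absolutelyContinuousOnInterval ht).exists_exp_mul_abs_max ht (-κ)
  obtain ⟨r', hr', hmax'⟩ := (hx.absCont t ht).exists_exp_mul_abs_max ht (-κ)
  set m := Real.exp (-κ * (r - s)) * |x r| with hm
  set m' := Real.exp (-κ * (r' - s)) * |x' r'| with hm'
  have hm0 : 0 ≤ m := by positivity
  have hm0' : 0 ≤ m' := by positivity
  have hexp : ∀ d, 0 ≤ d → Real.exp (-κ * d) ≤ 1 := fun d hd =>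
    Real.exp_le_one_iff.2 (by nlinarith)
  -- With a decaying weight a delay only helps, so `E = 1` serves for delays of any size.
  have hf := hx.exp_mul_abs_forcing_le (T := t) (μ := -κ) (E := 1) hC hm0 hm0' hA hB
    (fun t ht => ⟨hg t ht.1, hexp _ (sub_nonneg.2 (hg t ht.1)), fun _ => hexp _ (sub_nonneg.2 ht.1)⟩)
    (fun t ht => ⟨hh t ht.1, hexp _ (sub_nonneg.2 (hh t ht.1)), fun _ => hexp _ (sub_nonneg.2 ht.1)⟩)
    (fun r hr => hpre r hr.le) (fun r hr => hpre' r hr.le) hmax hmax'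
  have h1 := hx.exp_mul_abs_deriv_le ht hb (by linarith) (by positivity) hm0 hmax hf hr'
  have h2 := hx.exp_mul_abs_le (c := 0) (μ := -κ) ht (by linarith) hm0'
    (by simpa using hmax') hr
  rw [← hm'] at h1
  rw [← hm] at h2
  have h3 := hpre s le_rfl
  have h4 := hpre' s le_rfl
  have h5 : (A * (1 * (C + m')) + B * (1 * (C + m)) + b * m) / (a - -κ) ≤
      (A * (1 * (C + m')) + B * (1 * (C + m)) + b * m) / κ := by
    gcongr
    linarith
  have h6 : m' / (0 - -κ) = m' / κ := by ring_nf
  rw [h6] at h2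
  have h7 : m + m' ≤ 2 * C + (m' + (A * (1 * (C + m')) + B * (1 * (C + m)) + b * m)) / κ := by
    rw [add_div]; linarith
  have h8 : (m' + (A * (1 * (C + m')) + B * (1 * (C + m)) + b * m)) / κ ≤ (m + m' + C) / 2 := by
    rw [div_le_iff₀ hκ0, hκ]
    have := mul_nonneg hA0 hm0
    have := mul_nonneg hB0 hm0'
    have := mul_nonneg hb hm0'
    have := mul_nonneg hb hC
    nlinarith
  have h9 : m + m' ≤ 5 * C := by linarith
  have key : ∀ y : ℝ, Real.exp (-κ * (t - s)) * |y| ≤ 5 * C →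
      |y| ≤ 5 * C * Real.exp (κ * (t - s)) := by
    intro y hy
    rw [neg_mul, Real.exp_neg, inv_mul_le_iff₀ (Real.exp_pos _)] at hy
    linarith
  exact ⟨key _ ((hmax t (right_mem_Icc.2 ht)).trans (by linarith)),
    key _ ((hmax' t (right_mem_Icc.2 ht)).trans (by linarith))⟩

/-- Exponential decay, by a small-gain argument in the norm weighted with `exp (μ (t - s))`. -/
lemma exp_mul_abs_le_of_small_gain {p q : ℝ}
    (hx : SolvesFrom (p + q) (p * q) a₁ b₁ g h s x x') {A B C E μ τ : ℝ}
    (hμ : 0 < μ) (hp : μ < p) (hq : μ < q)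
    (hA0 : 0 ≤ A) (hB0 : 0 ≤ B) (hC : 0 ≤ C) (hE : E = Real.exp (μ * τ))
    (hA : ∀ᵐ t ∂volume.restrict (Ici s), |a₁ t| ≤ A)
    (hB : ∀ᵐ t ∂volume.restrict (Ici s), |b₁ t| ≤ B)
    (hg : ∀ t, s ≤ t → g t ≤ t ∧ t - g t ≤ τ) (hh : ∀ t, s ≤ t → h t ≤ t ∧ t - h t ≤ τ)
    (hgain₁ : 0 < p + q - μ - A * E)
    (hgain₂ : 0 < (p + q - μ - A * E) * ((p - μ) * (q - μ) - B * E) -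
      A * E * (p * q + B * E))
    (hpre : ∀ r, r ≤ s → |x r| ≤ C) (hpre' : ∀ r, r ≤ s → |x' r| ≤ C) {t : ℝ} (ht : s ≤ t) :
    Real.exp (μ * (t - s)) * |x t| ≤
      (((p - μ) * (q - μ) + (1 + q) * (p - μ) + A * E + B * E) * (p + q - μ - A * E) +
        A * E * (p + q - μ + A * E + B * E)) /
      ((p + q - μ - A * E) * ((p - μ) * (q - μ) - B * E) - A * E * (p * q + B * E)) * C := by
  obtain ⟨r, hr, hmax⟩ :=
    (hx.absolutelyContinuousOnInterval ht).exists_exp_mul_abs_max ht μ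
  obtain ⟨r', hr', hmax'⟩ := (hx.absCont t ht).exists_exp_mul_abs_max ht μ
  set m := Real.exp (μ * (r - s)) * |x r| with hm
  set m' := Real.exp (μ * (r' - s)) * |x' r'| with hm'
  have hm0 : 0 ≤ m := by positivity
  have hm0' : 0 ≤ m' := by positivity
  have hE0 : 0 < E := hE ▸ Real.exp_pos _
  have hexp : ∀ d, d ≤ τ → Real.exp (μ * d) ≤ E := fun d hd => by
    rw [hE]; gcongr
  -- A delayed argument before `s` forces `t - s < τ`, so the same `E` covers the prehistory.
  have hf := hx.exp_mul_abs_forcing_le (T := t) (μ := μ) (E := E) hC hm0 hm0' hA hB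
    (fun t ht => ⟨(hg t ht.1).1, hexp _ (hg t ht.1).2,
      fun h => hexp _ (by linarith [(hg t ht.1).2])⟩)
    (fun t ht => ⟨(hh t ht.1).1, hexp _ (hh t ht.1).2,
      fun h => hexp _ (by linarith [(hh t ht.1).2])⟩)
    (fun r hr => hpre r hr.le) (fun r hr => hpre' r hr.le) hmax hmax'
  have hp0 : 0 < p := hμ.trans hp
  have hq0 : 0 < q := hμ.trans hq
  have hpμ : 0 < p - μ := sub_pos.2 hp
  have hqμ : 0 < q - μ := sub_pos.2 hq
  have haμ : 0 < p + q - μ := by linarith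
  set F := A * (E * (C + m')) + B * (E * (C + m)) with hF
  have hF0 : 0 ≤ F := by positivity
  have h1 := hx.exp_mul_abs_deriv_le ht (by positivity) (by linarith) hF0 hm0 hmax hf hr'
  have h2 := hx.exp_mul_abs_le ht hq (by positivity)
    (fun t => hx.exp_mul_abs_factor_le ‹_› hp hF0 hf) hr
  rw [← hm'] at h1
  rw [← hm] at h2
  have h3 := hpre s le_rfl
  have h4 := hpre' s le_rfl
  have h5 : |x' s + q * x s| ≤ (1 + q) * C := by
    refine (abs_add_le _ _).trans ?_
    rw [abs_mul, abs_of_pos hq0]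
    nlinarith
  have h6 : m' * (p + q - μ) ≤ C * (p + q - μ) + (F + p * q * m) := by
    have : m' ≤ C + (F + p * q * m) / (p + q - μ) := by linarith
    calc _ ≤ (C + (F + p * q * m) / (p + q - μ)) * (p + q - μ) := by gcongr
      _ = _ := by field_simp
  have h7 : m * ((p - μ) * (q - μ)) ≤
      C * ((p - μ) * (q - μ)) + (1 + q) * C * (p - μ) + F := by
    have : m ≤ C + ((1 + q) * C + F / (p - μ)) / (q - μ) := by
      refine h2.trans ?_
      gcongr
    calc _ ≤ (C + ((1 + q) * C + F / (p - μ)) / (q - μ)) * ((p - μ) * (q - μ)) := by gcongr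
      _ = _ := by field_simp; ring
  refine (hmax t (right_mem_Icc.2 ht)).trans ?_
  rw [div_mul_eq_mul_div, le_div_iff₀ hgain₂]
  -- Elimination: with these multipliers the `m'` terms cancel in the sum of `h8` and `h9`.
  have h8 := mul_le_mul_of_nonneg_right h7 hgain₁.le
  have h9 := mul_le_mul_of_nonneg_left h6 (mul_nonneg hA0 hE0.le)
  rw [hF] at h8 h9
  linarith

end SolvesFrom



/-! ### Coefficients, delays and the choice of the weight -/

lemma supNorm_nonneg (t₀ : ℝ) (f : ℝ → ℝ) : 0 ≤ supNorm t₀ f := ENNReal.toReal_nonneg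

lemma IsCoefficient.ae_abs_le_supNorm {f : ℝ → ℝ} (hf : IsCoefficient f) {t₀ : ℝ} (ht₀ : 0 ≤ t₀) :
    ∀ᵐ t ∂volume.restrict (Ici t₀), |f t| ≤ supNorm t₀ f := by
  have hf' : MemLp f ⊤ (volume.restrict (Ici t₀)) :=
    hf.mono_measure (Measure.restrict_mono (Ici_subset_Ici.2 ht₀) le_rfl)
  have hne : eLpNorm f ⊤ (volume.restrict (Ici t₀)) ≠ ⊤ := hf'.2.ne
  have h := enorm_ae_le_eLpNormEssSup f (volume.restrict (Ici t₀))
  rw [← eLpNorm_exponent_top] at h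
  filter_upwards [h] with t ht
  have := ENNReal.toReal_mono hne ht
  simpa [supNorm] using this

lemma IsBoundedDelay.exists_delay_le {g : ℝ → ℝ} (hg : IsBoundedDelay g) :
    ∃ τ T, ∀ t, T ≤ t → t - g t ≤ τ := by
  obtain ⟨τ, hτ⟩ := hg.bounded
  obtain ⟨T, hT⟩ := eventually_atTop.1 (eventually_map.1 hτ)
  exact ⟨τ, T, hT⟩

/-- The small-gain conditions persist for small positive exponential weights. -/
lemma exists_weight {p q A B : ℝ} (hp : 0 < p) (hq : 0 < q) (τ : ℝ) (h₁ : A < p + q)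
    (h₂ : A * (p * q + B) < (p + q - A) * (p * q - B)) :
    ∃ μ, 0 < μ ∧ μ < p ∧ μ < q ∧ 0 < p + q - μ - A * Real.exp (μ * τ) ∧
      0 < (p + q - μ - A * Real.exp (μ * τ)) * ((p - μ) * (q - μ) - B * Real.exp (μ * τ)) -
        A * Real.exp (μ * τ) * (p * q + B * Real.exp (μ * τ)) := by
  -- All conditions are strict and continuous in `μ`, and at `μ = 0` they are the hypotheses.
  have key : ∀ f : ℝ → ℝ, Continuous f → 0 < f 0 → ∀ᶠ μ in nhdsWithin 0 (Ioi 0), 0 < f μ :=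
    fun f hf h0 => nhdsWithin_le_nhds (hf.continuousAt.eventually (lt_mem_nhds h0))
  have e₁ := key (fun μ => p + q - μ - A * Real.exp (μ * τ)) (by fun_prop) (by simpa using h₁)
  have e₂ := key (fun μ => (p + q - μ - A * Real.exp (μ * τ)) *
    ((p - μ) * (q - μ) - B * Real.exp (μ * τ)) -
      A * Real.exp (μ * τ) * (p * q + B * Real.exp (μ * τ))) (by fun_prop) (by simpa using h₂)
  have e₃ := key (fun μ => p - μ) (by fun_prop) (by simpa using hp)
  have e₄ := key (fun μ => q - μ) (by fun_prop) (by simpa using hq)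
  obtain ⟨μ, h₁, h₂, h₃, h₄, h₅⟩ := (e₁.and (e₂.and (e₃.and (e₄.and self_mem_nhdsWithin)))).exists
  exact ⟨μ, h₅, sub_pos.1 h₃, sub_pos.1 h₄, h₁, h₂⟩

lemma exists_pos_factorization {a b : ℝ} (ha : 0 < a) (hb : 0 < b) (hab : 4 * b ≤ a ^ 2) :
    ∃ p q, 0 < p ∧ 0 < q ∧ p + q = a ∧ p * q = b := by
  have hs := Real.sq_sqrt (sub_nonneg.2 hab)
  have hlt : √(a ^ 2 - 4 * b) < a := by
    rw [Real.sqrt_lt' ha]; linarith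
  exact ⟨(a + √(a ^ 2 - 4 * b)) / 2, (a - √(a ^ 2 - 4 * b)) / 2, by positivity, by linarith,
    by ring, by nlinarith⟩

lemma IsSolution.solvesFrom {a b : ℝ} {a₁ b₁ g h : ℝ → ℝ} {s : ℝ} {φ ψ : Iio s → ℝ} {x₀ x₀' : ℝ}
    {x x' : ℝ → ℝ} (hx : IsSolution (fun _ => a) (fun _ => b) a₁ b₁ g h s φ ψ x₀ x₀' x x') :
    SolvesFrom a b a₁ b₁ g h s x x' :=
  ⟨hx.hasDeriv, hx.absCont, hx.equation⟩

/-- Up to the initial time, a solution is bounded by the size of its initial data. -/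
lemma IsSolution.abs_le_initial {a b a₁ b₁ g h : ℝ → ℝ} {s : ℝ} {φ ψ : Iio s → ℝ} {x₀ x₀' : ℝ}
    {x x' : ℝ → ℝ} (hx : IsSolution a b a₁ b₁ g h s φ ψ x₀ x₀' x x')
    (hφ : BddAbove (range fun t => |φ t|)) (hψ : BddAbove (range fun t => |ψ t|)) {r : ℝ}
    (hr : r ≤ s) :
    |x r| ≤ |x₀| + |x₀'| + (⨆ s : Iio s, (|φ s| + |ψ s|)) ∧
      |x' r| ≤ |x₀| + |x₀'| + ⨆ s : Iio s, (|φ s| + |ψ s|) := by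
  have hbdd : BddAbove (range fun t => |φ t| + |ψ t|) := by
    obtain ⟨M, hM⟩ := hφ
    obtain ⟨N, hN⟩ := hψ
    refine ⟨M + N, ?_⟩
    rintro _ ⟨t, rfl⟩
    exact add_le_add (hM ⟨t, rfl⟩) (hN ⟨t, rfl⟩)
  have hsup : 0 ≤ ⨆ s : Iio s, (|φ s| + |ψ s|) := Real.iSup_nonneg fun _ => by positivity
  have h0 := abs_nonneg x₀
  have h0' := abs_nonneg x₀'
  rcases hr.lt_or_eq with hlt | rfl
  · have h1 := le_ciSup hbdd ⟨r, hlt⟩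
    have h2 := hx.eq_pre ⟨r, hlt⟩
    have h3 := hx.deriv_eq_pre ⟨r, hlt⟩
    simp only at h1 h2 h3
    rw [h2, h3]
    have := abs_nonneg (φ ⟨r, hlt⟩)
    have := abs_nonneg (ψ ⟨r, hlt⟩)
    constructor <;> linarith
  · rw [hx.eq_init, hx.deriv_eq_init]
    constructor <;> linarith

end DelayDE

/-! ### Uniformity in the initial time -/

theorem corollary4 (a b : ℝ) (ha : 0 < a) (hb : 0 < b) (hab : 4 * b ≤ a ^ 2)
    (a₁ b₁ g h : ℝ → ℝ)
    (ha₁ : DelayDE.IsCoefficient a₁) (hb₁ : DelayDE.IsCoefficient b₁)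
    (hg : DelayDE.IsBoundedDelay g) (hh : DelayDE.IsBoundedDelay h)
    (hnorm : ∃ t₀ : ℝ, 0 ≤ t₀ ∧ DelayDE.supNorm t₀ a₁ < a ∧
      DelayDE.supNorm t₀ a₁ * (b + DelayDE.supNorm t₀ b₁) <
        (a - DelayDE.supNorm t₀ a₁) * (b - DelayDE.supNorm t₀ b₁)) :
    DelayDE.IsExponentiallyStable (fun _ => a) (fun _ => b) a₁ b₁ g h := by
  obtain ⟨t₀, ht₀, hA, hAB⟩ := hnorm
  obtain ⟨p, q, hp, hq, rfl, rfl⟩ := DelayDE.exists_pos_factorization ha hb hab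
  obtain ⟨τg, Tg, hτg⟩ := hg.exists_delay_le
  obtain ⟨τh, Th, hτh⟩ := hh.exists_delay_le
  set τ := max τg τh
  -- From `T₀` on, both delays are at most `τ` and the norms over `[t₀, ∞)` apply.
  set T₀ := max t₀ (max Tg Th)
  have hT₀ : t₀ ≤ T₀ := le_max_left _ _
  have hTg : Tg ≤ T₀ := (le_max_left _ _).trans (le_max_right _ _)
  have hTh : Th ≤ T₀ := (le_max_right _ _).trans (le_max_right _ _)
  have hT₀0 : 0 ≤ T₀ := ht₀.trans hT₀
  obtain ⟨μ, hμ, hμp, hμq, hgain₁, hgain₂⟩ := DelayDE.exists_weight hp hq τ hA hAB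
  obtain ⟨K, hK⟩ : ∃ K : ℝ, ∀ s x x' C, T₀ ≤ s → 0 ≤ C →
      DelayDE.SolvesFrom (p + q) (p * q) a₁ b₁ g h s x x' →
      (∀ r, r ≤ s → |x r| ≤ C) → (∀ r, r ≤ s → |x' r| ≤ C) → ∀ t, s ≤ t →
      Real.exp (μ * (t - s)) * |x t| ≤ K * C :=
    ⟨_, fun s x x' C hs hC hx hpre hpre' t ht => hx.exp_mul_abs_le_of_small_gain hμ hμp hμq
      (DelayDE.supNorm_nonneg t₀ a₁) (DelayDE.supNorm_nonneg t₀ b₁) hC rfl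
      (ae_restrict_of_ae_restrict_of_subset (Ici_subset_Ici.2 (hT₀.trans hs))
        (ha₁.ae_abs_le_supNorm ht₀))
      (ae_restrict_of_ae_restrict_of_subset (Ici_subset_Ici.2 (hT₀.trans hs))
        (hb₁.ae_abs_le_supNorm ht₀))
      (fun t ht => ⟨hg.le_self t (hT₀0.trans (hs.trans ht)),
        (hτg t (hTg.trans (hs.trans ht))).trans (le_max_left _ _)⟩)
      (fun t ht => ⟨hh.le_self t (hT₀0.trans (hs.trans ht)),
        (hτh t (hTh.trans (hs.trans ht))).trans (le_max_right _ _)⟩)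
      hgain₁ hgain₂ hpre hpre' ht⟩
  -- Before `T₀` only the norms over `[0, ∞)` are available.
  set κ := 2 * (1 + p * q + DelayDE.supNorm 0 a₁ + DelayDE.supNorm 0 b₁) with hκ
  have hκ0 : 0 < κ := by
    have := DelayDE.supNorm_nonneg 0 a₁
    have := DelayDE.supNorm_nonneg 0 b₁
    positivity
  set L := 5 * Real.exp (κ * T₀) with hL
  have hL1 : 1 ≤ L := by
    have := Real.one_le_exp (mul_nonneg hκ0.le hT₀0)
    linarith
  have hμT : 1 ≤ Real.exp (μ * T₀) := Real.one_le_exp (mul_nonneg hμ.le hT₀0)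
  -- `1 + |K|` dominates both `K`, whose sign is not tracked, and 1. `L` pays for growth up to `T₀`,
  -- and `exp (μ * T₀)` for moving the origin of the weight from `s` to `T₀`.
  refine ⟨(1 + |K|) * L * Real.exp (μ * T₀), μ, by positivity, hμ, ?_⟩
  intro s hs φ ψ _ _ hφ hψ x₀ x₀' x x' hsol t ht
  set C := |x₀| + |x₀'| + ⨆ s : Iio s, (|φ s| + |ψ s|) with hCdef
  have hpre : ∀ r, r ≤ s → |x r| ≤ C := fun r hr => (hsol.abs_le_initial hφ hψ hr).1
  have hpre' : ∀ r, r ≤ s → |x' r| ≤ C := fun r hr => (hsol.abs_le_initial hφ hψ hr).2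
  have hC : 0 ≤ C := (abs_nonneg _).trans (hpre s le_rfl)
  have hx := hsol.solvesFrom
  -- It suffices to bound the weighted solution.
  suffices hmain : Real.exp (μ * (t - s)) * |x t| ≤ (1 + |K|) * L * Real.exp (μ * T₀) * C by
    rw [← le_div_iff₀' (Real.exp_pos _)] at hmain
    refine hmain.trans (le_of_eq ?_)
    rw [neg_mul, Real.exp_neg]
    ring
  have hKle : K ≤ 1 + |K| := by linarith [le_abs_self K]
  rcases le_or_gt T₀ s with hTs | hTs
  · calc _ ≤ K * C := hK s x x' C hTs hC hx hpre hpre' t ht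
      _ ≤ (1 + |K|) * 1 * 1 * C := by rw [mul_one, mul_one]; gcongr
      _ ≤ _ := by gcongr
  · have hgrow : ∀ r, r ≤ T₀ → |x r| ≤ L * C ∧ |x' r| ≤ L * C := by
      intro r hr
      rcases le_or_gt r s with hrs | hrs
      · exact ⟨(hpre r hrs).trans (le_mul_of_one_le_left hC hL1),
          (hpre' r hrs).trans (le_mul_of_one_le_left hC hL1)⟩
      · have h1 := hx.abs_le_exp_growth ha.le hb.le (DelayDE.supNorm_nonneg 0 a₁)
          (DelayDE.supNorm_nonneg 0 b₁) hC
          (ae_restrict_of_ae_restrict_of_subset (Ici_subset_Ici.2 hs)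
            (ha₁.ae_abs_le_supNorm le_rfl))
          (ae_restrict_of_ae_restrict_of_subset (Ici_subset_Ici.2 hs)
            (hb₁.ae_abs_le_supNorm le_rfl))
          (fun t ht => hg.le_self t (hs.trans ht)) (fun t ht => hh.le_self t (hs.trans ht))
          hpre hpre' hrs.le
        rw [← hκ] at h1
        have h2 : 5 * C * Real.exp (κ * (r - s)) ≤ L * C := by
          rw [hL, mul_right_comm]
          gcongr
          linarith
        exact ⟨h1.1.trans h2, h1.2.trans h2⟩
    rcases le_or_gt t T₀ with htT | htT
    · calc _ ≤ Real.exp (μ * T₀) * (L * C) := by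
            gcongr
            · linarith
            · exact (hgrow t htT).1
        _ = 1 * L * Real.exp (μ * T₀) * C := by ring
        _ ≤ _ := by gcongr; linarith [abs_nonneg K]
    -- Restart at `T₀`, where the whole past is bounded by `L * C`.
    · have h1 := hK T₀ x x' (L * C) le_rfl (by positivity) (hx.mono hTs.le)
        (fun r hr => (hgrow r hr).1) (fun r hr => (hgrow r hr).2) t htT.le
      calc _ ≤ Real.exp (μ * (T₀ + (t - T₀))) * |x t| := by
            gcongr
            linarith
        _ = Real.exp (μ * T₀) * (Real.exp (μ * (t - T₀)) * |x t|) := by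
            rw [mul_add, Real.exp_add]; ring
        _ ≤ Real.exp (μ * T₀) * (K * (L * C)) := by gcongr
        _ ≤ Real.exp (μ * T₀) * ((1 + |K|) * (L * C)) := by gcongr
        _ = _ := by ring
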